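/- **Asymptotic lower bound of the safety probability.** Let $S\subseteq\mathbb R^k$ be a measurable state space with measurable sets $S_0\subseteq S$ (initial) and $S_u\subseteq S$ (unsafe), let $T\ge 0$ be a horizon, let $P(\cdot\mid s,a)$ be the unknown Markovian dynamics of the environment with actions in $\mathbb R^m$, and let $\pi:\mathbb R^k\to\mathbb R^m$ be a continuous deterministic policy. Put $P^*(\cdot\mid s)=P(\cdot\mid s,\pi(s))$ and assume $P^*(S\mid s)=1$ for all $s\in S$. The initial state has a law $\mu_0$ with $\mu_0(S)=1$ and $\mu_0(S_0)>0$. The generative models are discrete-time stochastic differential equations $$\hat s(t+1)=G_\alpha(\hat s(t),\pi(\hat s(t)))+\Sigma_\alpha(\hat s(t))\,W(t),\qquad W(t)\sim\mathcal N(0,I_d)\text{ independent},$$ with continuous drift $G_\alpha$ and continuous, possibly degenerate, diffusion $\Sigma_\alpha\in\mathbb R^{k\times d}$, where $\alpha$ ranges over a finite set. Let $\hat P_\alpha(\cdot\mid s)$ denote the transition law of model $\alpha$, and $p_\alpha(s'\mid s)$ a jointly measurable, finite density of it with respect to a reference kernel common to all $\alpha$ (for instance Lebesgue measure). Assume that the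 class contains the true dynamics: for some $\alpha^*$, $\hat P_{\alpha^*}(\cdot\mid s)=P^*(\cdot\mid s)$ for all $s\in S$. Let $\tau^i=(s^i(0),\dots,s^i(T))$, $i=1,2,\dots$, be independent trajectories of the environment under $\pi$, each with initial law $\mu_0$ and transition law $P^*$. A maximum likelihood fit to $\tau^1,\dots,\tau^n$ is a parameter $\alpha$ that minimizes $-\sum_{i=1}^n\sum_{t=0}^{T-1}\log p_\alpha(s^i(t+1)\mid s^i(t))$ over the class (with $\log 0=-\infty$). A soft barrier function with value $\eta$ for the model $\alpha$ is a twice differentiable $B:\mathbb R^k\to\mathbb R$ with $B\ge 0$ on $S$, $B\ge 1$ on $S_u$, $B\le\eta$ on $S_0$ and, for every $s\in S$, $B$ is $\hat P_\alpha(\cdot\mid s)$-integrable with $\int B(s')\,\hat P_\alpha(ds'\mid s)\le B(s)$. Then the following hold. 1. Almost surely there is an $N$ such that for all $n\ge N$, for every maximum likelihood fit $\hat\alpha_n$ to the first $n$ trajectories, and for every soft barrier function for the model $\hat\alpha_n$, with value $\eta^*$, the real environment under $\pi$ satisfies $$\mathbb P\big(s(t)\notin S_u\ \text{for all } t\in\{0,\dots,T\}\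 \big|\ s(0)\in S_0\big)\ \ge\ 1-\eta^*.$$ 2. If moreover the data cover the state space, in the sense that almost surely the sampled states $s^i(t)$ ($i\ge 1$, $0\le t<T$) are dense in $S$, then almost surely there is an $N$ such that for all $n\ge N$, every such $\hat\alpha_n$ and every soft barrier function for the model $\hat\alpha_n$ with value $\eta^*$, the same lower bound holds from every initial state: for all $s_0\in S_0$, $\mathbb P_{s_0}\big(s(t)\notin S_u\ \text{for all } t\in\{0,\dots,T\}\big)\ge 1-\eta^*$. -/

import Mathlib

open MeasureTheory ProbabilityTheory Filter
open scoped NNReal ENNReal Matrix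

namespace SoftBarrier

/-- The space `ℝᵏ` with its Euclidean norm. -/
abbrev Euc (k : ℕ) : Type := EuclideanSpace ℝ (Fin k)

/-- A discrete-time stochastic differential equation model
`s(t+1) = G(s(t), a(t)) + Σ(s(t)) W(t)`: a continuous drift `G` and a continuous matrix-valued
diffusion `Σ`. The diffusion may be degenerate, or zero. -/
structure SDEModel (k m d : ℕ) where
  /-- the drift `G` -/
  drift : C(Euc k × Euc m, Euc k)
  /-- the diffusion `Σ` -/
  diffusion : C(Euc k, Matrix (Fin k) (Fin d) ℝ)

section Model

variable {k m d : ℕ}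

/-- One step of the model under the policy `π`, from the state `s` with noise value `w`. -/
def SDEModel.step (M : SDEModel k m d) (π : C(Euc k, Euc m)) (s : Euc k) (w : Euc d) : Euc k :=
  M.drift (s, π s) + WithLp.toLp 2 (M.diffusion s *ᵥ w.ofLp)

theorem SDEModel.continuous_step (M : SDEModel k m d) (π : C(Euc k, Euc m)) :
    Continuous (fun x : Euc k × Euc d => M.step π x.1 x.2) := by
  unfold SDEModel.step
  refine Continuous.add (by fun_prop) ?_
  refine (PiLp.continuous_toLp 2 _).comp ?_
  exact Continuous.matrix_mulVec (M.diffusion.continuous.comp continuous_fst)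
    ((PiLp.continuous_ofLp 2 _).comp continuous_snd)

/-- The closed-loop transition kernel of the model: the law of one step from `s`, where the noise
is a standard Gaussian vector of `ℝᵈ`. -/
noncomputable def SDEModel.transition (M : SDEModel k m d) (π : C(Euc k, Euc m)) :
    Kernel (Euc k) (Euc k) where
  toFun s := (stdGaussian (Euc d)).map (fun w => M.step π s w)
  measurable' := by
    have h := (M.continuous_step π).measurable
    have h2 := (Measure.measurable_map _ h).comp
      (Measurable.map_prodMk_left (α := Euc k) (ν := stdGaussian (Euc d)))
    convert h2 using 1
    funext s
    simp only [Function.comp_apply]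
    rw [Measure.map_map h measurable_prodMk_left]
    rfl

instance (M : SDEModel k m d) (π : C(Euc k, Euc m)) : IsMarkovKernel (M.transition π) where
  isProbabilityMeasure s :=
    Measure.isProbabilityMeasure_map
      ((M.continuous_step π).comp (Continuous.prodMk_right s)).aemeasurable

/-- The closed-loop transition kernel `P(· | s, π(s))` of an environment with dynamics
`P(· | s, a)` under the deterministic policy `π`. -/
noncomputable def closedLoop (P : Kernel (Euc k × Euc m) (Euc k)) (π : C(Euc k, Euc m)) :
    Kernel (Euc k) (Euc k) :=
  P.comap (fun s => (s, π s)) (measurable_id.prodMk π.continuous.measurable)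

instance (P : Kernel (Euc k × Euc m) (Euc k)) [IsMarkovKernel P] (π : C(Euc k, Euc m)) :
    IsMarkovKernel (closedLoop P π) := by
  unfold closedLoop; infer_instance

end Model

section Trajectories

variable {k : ℕ}

/-- The law of the trajectory `(s(0), …, s(T))` of the Markov chain with initial law `μ` and
transition kernel `κ`. -/
noncomputable def trajLaw (μ : Measure (Euc k)) (κ : Kernel (Euc k) (Euc k)) :
    (T : ℕ) → Measure (Fin (T + 1) → Euc k)
  | 0 => μ.map (fun s _ => s)
  | T + 1 =>
    ((trajLaw μ κ T) ⊗ₘ (κ.comap (fun τ => τ (Fin.last T)) (measurable_pi_apply _))).map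
      (fun x => Fin.snoc (α := fun _ => Euc k) x.1 x.2)

theorem measurable_snoc (T : ℕ) :
    Measurable (fun x : (Fin (T + 1) → Euc k) × Euc k =>
      (Fin.snoc (α := fun _ => Euc k) x.1 x.2 : Fin (T + 2) → Euc k)) := by
  refine measurable_pi_lambda _ fun i => ?_
  refine Fin.lastCases ?_ (fun j => ?_) i
  · simpa using measurable_snd
  · simpa [Function.comp_def] using
      (measurable_pi_apply (X := fun _ : Fin (T + 1) => Euc k) j).comp
        (measurable_fst (α := Fin (T + 1) → Euc k) (β := Euc k))

instance (μ : Measure (Euc k)) [IsProbabilityMeasure μ] (κ : Kernel (Euc k) (Euc k))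
    [IsMarkovKernel κ] (T : ℕ) : IsProbabilityMeasure (trajLaw μ κ T) := by
  induction T with
  | zero =>
    exact Measure.isProbabilityMeasure_map (measurable_pi_lambda _ fun _ => measurable_id).aemeasurable
  | succ T ih => exact Measure.isProbabilityMeasure_map (measurable_snoc T).aemeasurable

/-- The event that a trajectory avoids the unsafe set at all times `0, …, T`. -/
def safeEvent (Su : Set (Euc k)) (T : ℕ) : Set (Fin (T + 1) → Euc k) :=
  {τ | ∀ t, τ t ∉ Su}

/-- The conditional probability `P(s(t) ∉ Su for all t ∈ {0, …, T} | s(0) ∈ S0)` for the chain with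
initial law `μ` and transition kernel `κ`. -/
noncomputable def safetyProb (μ : Measure (Euc k)) (κ : Kernel (Euc k) (Euc k))
    (S0 Su : Set (Euc k)) (T : ℕ) : ℝ :=
  (ProbabilityTheory.cond (trajLaw μ κ T) {τ | τ 0 ∈ S0}).real (safeEvent Su T)

/-- `B` is a soft barrier function with value `η` for the chain with transition kernel `κ` on the
state space `S`: it is twice differentiable, nonnegative on `S`, at least `1` on the unsafe set `Su`,
at most `η` on the initial set `S0`, and `𝔼[B(s(t+1)) | s(t) = s] ≤ B(s)` at every state `s`
of `S`. -/
structure IsSoftBarrier (κ : Kernel (Euc k) (Euc k)) (S S0 Su : Set (Euc k))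
    (B : Euc k → ℝ) (η : ℝ) : Prop where
  differentiable : Differentiable ℝ B
  differentiable_fderiv : Differentiable ℝ (fderiv ℝ B)
  nonneg : ∀ s ∈ S, 0 ≤ B s
  one_le : ∀ s ∈ Su, 1 ≤ B s
  le_value : ∀ s ∈ S0, B s ≤ η
  integrable : ∀ s ∈ S, Integrable B (κ s)
  integral_le : ∀ s ∈ S, ∫ s', B s' ∂(κ s) ≤ B s

end Trajectories

section Likelihood

variable {k : ℕ} {ι : Type*}

/-- `p(s, s') = p(s' | s)` is a transition density of `κ` with respect to the reference kernel `ν`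
(for instance `ν s` is Lebesgue measure for every `s`, and `p(s, ·)` a Gaussian density). -/
def IsTransitionDensity (ν κ : Kernel (Euc k) (Euc k)) (p : Euc k → Euc k → ℝ≥0) : Prop :=
  Measurable (Function.uncurry p) ∧ ∀ s, κ s = (ν s).withDensity (fun s' => (p s s' : ℝ≥0∞))

/-- The maximum likelihood loss of a transition density `p` on the first `n` trajectories of `τ`:
`- ∑ᵢ ∑ₜ log p(sⁱ(t+1) | sⁱ(t))`, an extended real number (`log 0 = -∞`). -/
noncomputable def likelihoodLoss {T : ℕ} (p : Euc k → Euc k → ℝ≥0) (n : ℕ)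
    (τ : ℕ → Fin (T + 1) → Euc k) : EReal :=
  -(∑ i ∈ Finset.range n, ∑ t : Fin T, ENNReal.log (p (τ i t.castSucc) (τ i t.succ) : ℝ≥0∞))

/-- The parameter `α` is a maximum likelihood fit, within the class of transition densities
`(p α)`, to the first `n` trajectories of `τ`. -/
def IsMaxLikelihood {T : ℕ} (p : ι → Euc k → Euc k → ℝ≥0) (n : ℕ)
    (τ : ℕ → Fin (T + 1) → Euc k) (α : ι) : Prop :=
  ∀ α', likelihoodLoss (p α) n τ ≤ likelihoodLoss (p α') n τ

/-- The sampled states from which a transition is observed become dense in `S` as the number of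
trajectories grows. -/
def DataCovers {T : ℕ} (S : Set (Euc k)) (τ : ℕ → Fin (T + 1) → Euc k) : Prop :=
  S ⊆ closure {s | ∃ (i : ℕ) (t : Fin T), s = τ i t.castSucc}

end Likelihood

end SoftBarrier

open SoftBarrier

/-!
A soft barrier `B` makes `B (s(t))` a nonnegative supermartingale for any chain that follows the
model's transitions, so Ville's maximal inequality bounds the probability of entering the unsafe set,
where `B ≥ 1`, by the initial value of `B`, which is at most `η`. Only the transitions from states
that the chain visits enter this argument (`IsSoftBarrier.measure_unsafe_le`). It therefore suffices
that the fitted model agrees with the environment at almost every visited state.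

That is the consistency of maximum likelihood over a finite class
(`ae_eventually_likelihoodLoss_lt`). It is proved with the Hellinger affinity: the expectation of the
square root of a likelihood ratio is at most `1`, with equality only if the two laws coincide. For
log-likelihood ratios one would have to deal with expectations equal to `-∞`; the square roots are
always integrable. Along a trajectory the affinities of the single transitions combine, and a model
that disagrees with the environment on visited states has an affinity `ρ < 1`
(`lintegral_transitionProd_sqrtRatio_lt_one`). By independence and Markov's inequality it beats the
true model on `n` trajectories with probability at most `ρ ^ n`, which is summable, and the
Borel–Cantelli lemma applies.

When the data are dense in `S`, the fitted and the true model have equal transitions at all sampled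
states. The transition kernels of the models have the Feller property, so the set where two of them
are equal is closed (`SDEModel.isClosed_setOf_transition_eq`) and contains `S`. The environment can
then be started at any `s0 ∈ S0`, with a Dirac mass as its initial law.
-/

namespace SoftBarrier

/-! ### Integration against the law of a trajectory -/

theorem measurableSet_apply_mem {k n : ℕ} {A : Set (Euc k)} (hA : MeasurableSet A) (i : Fin n) :
    MeasurableSet {τ : Fin n → Euc k | τ i ∈ A} :=
  measurable_pi_apply (X := fun _ : Fin n => Euc k) i hA

section TrajLaw

variable {k : ℕ} {μ : Measure (Euc k)} {κ : Kernel (Euc k) (Euc k)}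

theorem ae_trajLaw_succ {T : ℕ} {p : (Fin (T + 2) → Euc k) → Prop} (hp : MeasurableSet {τ | p τ})
    (h : ∀ᵐ τ ∂(trajLaw μ κ T), ∀ᵐ s ∂(κ (τ (Fin.last T))),
      p (Fin.snoc (α := fun _ => Euc k) τ s)) :
    ∀ᵐ τ ∂(trajLaw μ κ (T + 1)), p τ := by
  rw [trajLaw, ae_map_iff (measurable_snoc T).aemeasurable hp]
  exact Measure.ae_compProd_of_ae_ae (measurable_snoc T hp) h

/-- A property of pairs which holds for almost every transition at each time holds along almost
every trajectory. -/
theorem ae_trajLaw_forall_transition {W : Set (Euc k × Euc k)} (hW : MeasurableSet W) {T : ℕ}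
    (h : ∀ t < T, ∀ᵐ τ ∂(trajLaw μ κ t), ∀ᵐ s ∂(κ (τ (Fin.last t))), (τ (Fin.last t), s) ∈ W) :
    ∀ᵐ τ ∂(trajLaw μ κ T), ∀ i : Fin T, (τ i.castSucc, τ i.succ) ∈ W := by
  induction T with
  | zero => exact .of_forall fun _ i => i.elim0
  | succ T ih =>
    refine ae_trajLaw_succ ?_ ?_
    · rw [Set.ofPred_forall]
      exact MeasurableSet.iInter fun i =>
        ((measurable_pi_apply _).prodMk (measurable_pi_apply _)) hW
    · filter_upwards [h T T.lt_succ_self, ih fun t ht => h t (ht.trans T.lt_succ_self)]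
        with τ h1 h2
      filter_upwards [h1] with s hs
      intro i
      refine Fin.lastCases ?_ (fun j => ?_) i
      · rw [Fin.succ_last]
        simpa only [Fin.snoc_castSucc, Fin.snoc_last] using hs
      · rw [Fin.succ_castSucc]
        simpa only [Fin.snoc_castSucc] using h2 j

theorem ae_trajLaw_last_mem {S : Set (Euc k)} (hS : MeasurableSet S)
    (hκ : ∀ s ∈ S, κ s Sᶜ = 0) (hμ : μ Sᶜ = 0) (t : ℕ) :
    ∀ᵐ τ ∂(trajLaw μ κ t), τ (Fin.last t) ∈ S := by
  induction t with
  | zero =>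
    rw [trajLaw, ae_map_iff (by fun_prop) (measurableSet_apply_mem hS _)]
    exact hμ
  | succ t ih =>
    refine ae_trajLaw_succ (measurableSet_apply_mem hS _) ?_
    filter_upwards [ih] with τ hτ
    simpa using show ∀ᵐ s ∂(κ (τ (Fin.last t))), s ∈ S from hκ _ hτ

variable [IsProbabilityMeasure μ] [IsMarkovKernel κ]

theorem lintegral_trajLaw_succ (T : ℕ) {F : (Fin (T + 2) → Euc k) → ℝ≥0∞} (hF : Measurable F) :
    ∫⁻ τ, F τ ∂(trajLaw μ κ (T + 1)) =
      ∫⁻ τ, ∫⁻ s, F (Fin.snoc (α := fun _ => Euc k) τ s) ∂(κ (τ (Fin.last T)))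
        ∂(trajLaw μ κ T) := by
  rw [trajLaw, lintegral_map hF (measurable_snoc T),
    Measure.lintegral_compProd (f := fun x => F (Fin.snoc (α := fun _ => Euc k) x.1 x.2))
      (hF.comp (measurable_snoc T))]
  rfl

theorem trajLaw_map_init (T : ℕ) :
    (trajLaw μ κ (T + 1)).map (fun τ i => τ (Fin.castSucc i)) = trajLaw μ κ T := by
  rw [trajLaw, Measure.map_map (by fun_prop) (measurable_snoc T)]
  conv_rhs => rw [← Measure.fst_compProd (trajLaw μ κ T)
    (κ.comap (fun τ => τ (Fin.last T)) (measurable_pi_apply _))]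
  rw [Measure.fst]
  congr 1
  funext x i
  simp

/-- A property of states which holds almost surely at each time before `T` holds simultaneously at
all those times. The set of states with this property need not be measurable. -/
theorem ae_trajLaw_forall_lt {R : Euc k → Prop} {T : ℕ}
    (h : ∀ t < T, ∀ᵐ τ ∂(trajLaw μ κ t), R (τ (Fin.last t))) :
    ∀ᵐ τ ∂(trajLaw μ κ T), ∀ i : Fin T, R (τ i.castSucc) := by
  induction T with
  | zero => exact .of_forall fun _ i => i.elim0
  | succ T ih =>
    have h1 : ∀ᵐ τ ∂(trajLaw μ κ T), ∀ i : Fin (T + 1), R (τ i) := by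
      filter_upwards [h T T.lt_succ_self, ih fun t ht => h t (ht.trans T.lt_succ_self)]
        with τ h1 h2 i
      exact Fin.lastCases h1 h2 i
    rw [← trajLaw_map_init T] at h1
    exact ae_of_ae_map (measurable_pi_lambda _ fun i => measurable_pi_apply _).aemeasurable h1

theorem trajLaw_zero_mem {A : Set (Euc k)} (hA : MeasurableSet A) (T : ℕ) :
    trajLaw μ κ T {τ | τ 0 ∈ A} = μ A := by
  induction T with
  | zero =>
    rw [trajLaw, Measure.map_apply (by fun_prop) (measurableSet_apply_mem hA _)]
    rfl
  | succ T ih =>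
    rw [← ih, ← trajLaw_map_init T,
      Measure.map_apply (by fun_prop) (measurableSet_apply_mem hA _)]
    rfl

end TrajLaw

/-! ### The supermartingale inequality for a barrier -/

section Barrier

variable {k : ℕ} {μ : Measure (Euc k)} [IsProbabilityMeasure μ]
  {κ : Kernel (Euc k) (Euc k)} [IsMarkovKernel κ]

theorem measurableSet_safeEvent {Su : Set (Euc k)} (hSu : MeasurableSet Su) (T : ℕ) :
    MeasurableSet (safeEvent Su T) := by
  rw [safeEvent, Set.ofPred_forall]
  exact MeasurableSet.iInter fun i => measurableSet_apply_mem hSu.compl i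

open Classical in
/-- The process `f (s(t))` stopped at the value `1` when the trajectory enters `Su`, and restricted
to the trajectories that start in `A`. -/
noncomputable def stoppedValue (f : Euc k → ℝ≥0∞) (A Su : Set (Euc k)) (T : ℕ)
    (τ : Fin (T + 1) → Euc k) : ℝ≥0∞ :=
  if τ 0 ∈ A then (if τ ∈ safeEvent Su T then f (τ (Fin.last T)) else 1) else 0

theorem measurable_stoppedValue {f : Euc k → ℝ≥0∞} (hf : Measurable f) {A Su : Set (Euc k)}
    (hA : MeasurableSet A) (hSu : MeasurableSet Su) (T : ℕ) :
    Measurable (stoppedValue f A Su T) :=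
  Measurable.ite (measurableSet_apply_mem hA _)
    (Measurable.ite (measurableSet_safeEvent hSu T) (hf.comp (measurable_pi_apply _))
      measurable_const) measurable_const

theorem snoc_mem_safeEvent {Su : Set (Euc k)} {T : ℕ} (τ : Fin (T + 1) → Euc k) (s : Euc k) :
    Fin.snoc (α := fun _ => Euc k) τ s ∈ safeEvent Su (T + 1) ↔ τ ∈ safeEvent Su T ∧ s ∉ Su := by
  simp only [safeEvent, Set.mem_ofPred_eq]
  constructor
  · intro h
    exact ⟨fun i => by simpa using h i.castSucc, by simpa using h (Fin.last _)⟩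
  · rintro ⟨h1, h2⟩ i
    refine Fin.lastCases ?_ (fun j => ?_) i
    · simpa using h2
    · simpa using h1 j

theorem snoc_zero {T : ℕ} (τ : Fin (T + 1) → Euc k) (s : Euc k) :
    Fin.snoc (α := fun _ => Euc k) τ s (0 : Fin (T + 2)) = τ 0 := by
  rw [← Fin.castSucc_zero, Fin.snoc_castSucc]

theorem lintegral_stoppedValue_le {f : Euc k → ℝ≥0∞} (hf : Measurable f) {A Su : Set (Euc k)}
    (hA : MeasurableSet A) (hSu : MeasurableSet Su) (hfSu : ∀ s ∈ Su, 1 ≤ f s) {T : ℕ}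
    (h : ∀ t < T, ∀ᵐ τ ∂(trajLaw μ κ t),
      ∫⁻ s, f s ∂(κ (τ (Fin.last t))) ≤ f (τ (Fin.last t))) :
    ∫⁻ τ, stoppedValue f A Su T τ ∂(trajLaw μ κ T) ≤ ∫⁻ s in A, f s ∂μ := by
  classical
  induction T with
  | zero =>
    rw [trajLaw, lintegral_map (measurable_stoppedValue hf hA hSu 0) (by fun_prop),
      ← lintegral_indicator hA]
    refine lintegral_mono fun s => ?_
    simp only [stoppedValue, Set.indicator]
    split_ifs with h1 h2
    · exact le_rfl
    · refine hfSu s ?_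
      simpa [safeEvent] using h2
    · exact le_rfl
  | succ T ih =>
    refine le_trans ?_ (ih fun t ht => h t (ht.trans T.lt_succ_self))
    rw [lintegral_trajLaw_succ T (measurable_stoppedValue hf hA hSu _)]
    refine lintegral_mono_ae ?_
    filter_upwards [h T T.lt_succ_self] with τ hτ
    simp only [stoppedValue, snoc_mem_safeEvent, snoc_zero, Fin.snoc_last]
    by_cases h0 : τ 0 ∈ A
    · by_cases h1 : τ ∈ safeEvent Su T
      · simp only [h0, h1, if_true, true_and]
        refine le_trans (lintegral_mono fun s => ?_) hτ
        split_ifs with h2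
        · exact hfSu s h2
        · exact le_rfl
      · simp [h0, h1]
    · simp [h0]

/-- A soft barrier function for a kernel which agrees with the environment at almost every visited
state bounds the probability of starting in `A ⊆ S0` and then reaching the unsafe set. -/
theorem IsSoftBarrier.measure_unsafe_le {κ' : Kernel (Euc k) (Euc k)} {S S0 Su : Set (Euc k)}
    {B : Euc k → ℝ} {η : ℝ} (hB : IsSoftBarrier κ' S S0 Su B η)
    (hS : MeasurableSet S) (hSu : MeasurableSet Su)
    (hκ : ∀ s ∈ S, κ s Sᶜ = 0) (hμ : μ Sᶜ = 0) {T : ℕ}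
    (h : ∀ t < T, ∀ᵐ τ ∂(trajLaw μ κ t), κ' (τ (Fin.last t)) = κ (τ (Fin.last t)))
    {A : Set (Euc k)} (hA : MeasurableSet A) (hAS0 : A ⊆ S0) :
    trajLaw μ κ T ({τ | τ 0 ∈ A} ∩ (safeEvent Su T)ᶜ) ≤ ENNReal.ofReal η * μ A := by
  have hBm : Measurable fun s => ENNReal.ofReal (B s) :=
    hB.differentiable.continuous.measurable.ennreal_ofReal
  have key := lintegral_stoppedValue_le (μ := μ) (κ := κ) hBm hA hSu
    (fun s hs => by simpa using hB.one_le s hs) (T := T) (fun t ht => by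
      filter_upwards [h t ht, ae_trajLaw_last_mem hS hκ hμ t] with τ h1 h2
      rw [← ofReal_integral_eq_lintegral_ofReal (h1 ▸ hB.integrable _ h2)]
      · exact ENNReal.ofReal_le_ofReal (h1 ▸ hB.integral_le _ h2)
      · have : ∀ᵐ s ∂(κ (τ (Fin.last t))), s ∈ S := hκ _ h2
        filter_upwards [this] with s hs using hB.nonneg s hs)
  calc trajLaw μ κ T ({τ | τ 0 ∈ A} ∩ (safeEvent Su T)ᶜ)
      = ∫⁻ τ, ({τ | τ 0 ∈ A} ∩ (safeEvent Su T)ᶜ).indicator 1 τ ∂(trajLaw μ κ T) := by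
        rw [lintegral_indicator_one]
        exact (measurableSet_apply_mem hA (0 : Fin (T + 1))).inter
          (measurableSet_safeEvent hSu T).compl
    _ ≤ ∫⁻ τ, stoppedValue (fun s => ENNReal.ofReal (B s)) A Su T τ ∂(trajLaw μ κ T) := by
        refine lintegral_mono fun τ => Set.indicator_le (fun τ hτ => ?_) τ
        have h0 : τ 0 ∈ A := hτ.1
        have h1 : τ ∉ safeEvent Su T := hτ.2
        simp [stoppedValue, h0, h1]
    _ ≤ ∫⁻ s in A, ENNReal.ofReal (B s) ∂μ := key
    _ ≤ ∫⁻ _ in A, ENNReal.ofReal η ∂μ :=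
        setLIntegral_mono measurable_const
          fun s hs => ENNReal.ofReal_le_ofReal (hB.le_value s (hAS0 hs))
    _ = ENNReal.ofReal η * μ A := setLIntegral_const _ _

/-- The value of a soft barrier function bounds the probability of leaving the safe set, given that
the trajectory starts in `S0`. -/
theorem IsSoftBarrier.one_sub_le_safetyProb {κ' : Kernel (Euc k) (Euc k)} {S S0 Su : Set (Euc k)}
    {B : Euc k → ℝ} {η : ℝ} (hB : IsSoftBarrier κ' S S0 Su B η)
    (hS : MeasurableSet S) (hS0 : MeasurableSet S0) (hSu : MeasurableSet Su) (hS0S : S0 ⊆ S)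
    (hκ : ∀ s ∈ S, κ s Sᶜ = 0) (hμ : μ Sᶜ = 0) (hμ0 : μ S0 ≠ 0) {T : ℕ}
    (h : ∀ t < T, ∀ᵐ τ ∂(trajLaw μ κ t), κ' (τ (Fin.last t)) = κ (τ (Fin.last t))) :
    1 - η ≤ safetyProb μ κ S0 Su T := by
  obtain ⟨s, hs⟩ : S0.Nonempty := Set.nonempty_iff_ne_empty.mpr fun h0 => hμ0 (by simp [h0])
  have hη : 0 ≤ η := (hB.nonneg s (hS0S hs)).trans (hB.le_value s hs)
  have hE : MeasurableSet {τ : Fin (T + 1) → Euc k | τ 0 ∈ S0} := measurableSet_apply_mem hS0 _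
  have hE0 : trajLaw μ κ T {τ | τ 0 ∈ S0} = μ S0 := trajLaw_zero_mem hS0 T
  have hle := hB.measure_unsafe_le hS hSu hκ hμ h hS0 subset_rfl
  have : IsProbabilityMeasure (ProbabilityTheory.cond (trajLaw μ κ T) {τ | τ 0 ∈ S0}) :=
    cond_isProbabilityMeasure (by rwa [hE0])
  have hc : (ProbabilityTheory.cond (trajLaw μ κ T) {τ | τ 0 ∈ S0}) (safeEvent Su T)ᶜ
      ≤ ENNReal.ofReal η := by
    rw [cond_apply hE, hE0]
    refine (mul_le_mul_right hle _).trans ?_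
    rw [mul_left_comm, ENNReal.inv_mul_cancel hμ0 (measure_ne_top _ _), mul_one]
  have hr := ENNReal.toReal_le_of_le_ofReal hη hc
  have hsub := probReal_compl_eq_one_sub
    (μ := ProbabilityTheory.cond (trajLaw μ κ T) {τ | τ 0 ∈ S0}) (measurableSet_safeEvent hSu T)
  rw [safetyProb]
  rw [measureReal_def] at hsub
  linarith

theorem safetyProb_eq_of_measure_eq_one {S0 Su : Set (Euc k)} (hS0 : MeasurableSet S0)
    (hμ : μ S0 = 1) {T : ℕ} : safetyProb μ κ S0 Su T = (trajLaw μ κ T).real (safeEvent Su T) := by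
  have hE := trajLaw_zero_mem (μ := μ) (κ := κ) hS0 T
  have hae : ∀ᵐ τ ∂(trajLaw μ κ T), τ ∈ {τ : Fin (T + 1) → Euc k | τ 0 ∈ S0} := by
    rw [ae_mem_iff_measure_eq (measurableSet_apply_mem hS0 _).nullMeasurableSet, hE, hμ,
      measure_univ]
  rw [safetyProb, ProbabilityTheory.cond, Measure.restrict_eq_self_of_ae_mem hae, hE, hμ,
    inv_one, one_smul]

end Barrier

/-! ### The square root of a likelihood ratio -/

/-- The square root of the likelihood ratio `f / g`, with value `0` where `g` vanishes. -/
noncomputable def sqrtRatio (f g : ℝ≥0) : ℝ≥0∞ := (NNReal.sqrt (f / g) : ℝ≥0)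

theorem sqrtRatio_sq_mul_le (f g : ℝ≥0) : (g : ℝ≥0∞) * sqrtRatio f g ^ 2 ≤ f := by
  rw [sqrtRatio, ← ENNReal.coe_pow, NNReal.sq_sqrt, ← ENNReal.coe_mul, ENNReal.coe_le_coe]
  rcases eq_or_ne g 0 with rfl | hg
  · simp
  · rw [mul_div_cancel₀ _ hg]

theorem sqrtRatio_eq_one {f g : ℝ≥0} (hg : g ≠ 0) : sqrtRatio f g = 1 ↔ f = g := by
  rw [sqrtRatio, ENNReal.coe_eq_one, NNReal.sqrt_eq_one, div_eq_one_iff_eq hg]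

theorem two_mul_sqrtRatio_le (f g : ℝ≥0) : 2 * sqrtRatio f g ≤ 1 + sqrtRatio f g ^ 2 := by
  rw [sqrtRatio]
  norm_cast
  rw [← NNReal.coe_le_coe]
  push_cast
  nlinarith [sq_nonneg (√((f : ℝ) / g) - 1)]

theorem eq_one_of_two_mul_sqrtRatio_eq {f g : ℝ≥0}
    (h : 2 * sqrtRatio f g = 1 + sqrtRatio f g ^ 2) : sqrtRatio f g = 1 := by
  rw [sqrtRatio] at h ⊢
  norm_cast at h ⊢
  rw [← NNReal.coe_inj] at h ⊢
  push_cast at h ⊢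
  nlinarith [sq_nonneg (√((f : ℝ) / g) - 1)]

theorem _root_.Measurable.sqrtRatio {X : Type*} [MeasurableSpace X] {f g : X → ℝ≥0}
    (hf : Measurable f) (hg : Measurable g) : Measurable fun x => sqrtRatio (f x) (g x) := by
  unfold SoftBarrier.sqrtRatio
  exact (NNReal.continuous_sqrt.measurable.comp (hf.div hg)).coe_nnreal_ennreal

section Hellinger

variable {X : Type*} [MeasurableSpace X] {ν : Measure X} {f g : X → ℝ≥0}

theorem lintegral_sqrtRatio_sq_le (hf : Measurable f) (hg : Measurable g)
    [IsProbabilityMeasure (ν.withDensity fun x => (f x : ℝ≥0∞))] :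
    ∫⁻ x, sqrtRatio (f x) (g x) ^ 2 ∂(ν.withDensity fun x => (g x : ℝ≥0∞)) ≤ 1 := by
  rw [lintegral_withDensity_eq_lintegral_mul _ hg.coe_nnreal_ennreal
    ((hf.sqrtRatio hg).pow_const 2)]
  calc _ ≤ ∫⁻ x, (f x : ℝ≥0∞) ∂ν := lintegral_mono fun x => sqrtRatio_sq_mul_le _ _
    _ = 1 := by
      rw [← setLIntegral_univ, ← withDensity_apply _ MeasurableSet.univ, measure_univ]

theorem lintegral_one_add_sqrtRatio_sq_le (hf : Measurable f) (hg : Measurable g)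
    [IsProbabilityMeasure (ν.withDensity fun x => (f x : ℝ≥0∞))]
    [IsProbabilityMeasure (ν.withDensity fun x => (g x : ℝ≥0∞))] :
    ∫⁻ x, (1 + sqrtRatio (f x) (g x) ^ 2) ∂(ν.withDensity fun x => (g x : ℝ≥0∞)) ≤ 2 := by
  rw [lintegral_add_left measurable_const, lintegral_one, measure_univ]
  exact (add_le_add_right (lintegral_sqrtRatio_sq_le (ν := ν) hf hg) 1).trans_eq one_add_one_eq_two

/-- The Hellinger affinity of two probability measures is at most `1`. -/
theorem lintegral_sqrtRatio_le_one (hf : Measurable f) (hg : Measurable g)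
    [IsProbabilityMeasure (ν.withDensity fun x => (f x : ℝ≥0∞))]
    [IsProbabilityMeasure (ν.withDensity fun x => (g x : ℝ≥0∞))] :
    ∫⁻ x, sqrtRatio (f x) (g x) ∂(ν.withDensity fun x => (g x : ℝ≥0∞)) ≤ 1 := by
  have h2 : 2 * ∫⁻ x, sqrtRatio (f x) (g x) ∂(ν.withDensity fun x => (g x : ℝ≥0∞)) ≤ 2 * 1 := by
    rw [← lintegral_const_mul _ (hf.sqrtRatio hg), mul_one]
    exact (lintegral_mono fun x => two_mul_sqrtRatio_le _ _).trans
      (lintegral_one_add_sqrtRatio_sq_le hf hg)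
  exact (ENNReal.mul_le_mul_iff_right two_ne_zero ENNReal.ofNat_ne_top).mp h2

/-- Equality case of the Hellinger affinity bound: the likelihood ratio is almost surely `1`. -/
theorem ae_sqrtRatio_eq_one (hf : Measurable f) (hg : Measurable g)
    [IsProbabilityMeasure (ν.withDensity fun x => (f x : ℝ≥0∞))]
    [IsProbabilityMeasure (ν.withDensity fun x => (g x : ℝ≥0∞))]
    (h : ∫⁻ x, sqrtRatio (f x) (g x) ∂(ν.withDensity fun x => (g x : ℝ≥0∞)) = 1) :
    ∀ᵐ x ∂(ν.withDensity fun x => (g x : ℝ≥0∞)), sqrtRatio (f x) (g x) = 1 := by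
  have hm := hf.sqrtRatio hg
  have h2 : ∫⁻ x, 2 * sqrtRatio (f x) (g x) ∂(ν.withDensity fun x => (g x : ℝ≥0∞)) = 2 := by
    rw [lintegral_const_mul _ hm, h, mul_one]
  have := ae_eq_of_ae_le_of_lintegral_le (μ := ν.withDensity fun x => (g x : ℝ≥0∞))
    (.of_forall fun x => two_mul_sqrtRatio_le (f x) (g x)) (by rw [h2]; exact ENNReal.ofNat_ne_top)
    (measurable_const.add (hm.pow_const 2)).aemeasurable
    (h2.symm ▸ lintegral_one_add_sqrtRatio_sq_le hf hg :
      _ ≤ ∫⁻ x, 2 * sqrtRatio (f x) (g x) ∂(ν.withDensity fun x => (g x : ℝ≥0∞)))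
  filter_upwards [this] with x hx using eq_one_of_two_mul_sqrtRatio_eq hx

theorem withDensity_eq_of_ae_sqrtRatio_eq_one (hg : Measurable g)
    [IsProbabilityMeasure (ν.withDensity fun x => (f x : ℝ≥0∞))]
    [IsProbabilityMeasure (ν.withDensity fun x => (g x : ℝ≥0∞))]
    (h : ∀ᵐ x ∂(ν.withDensity fun x => (g x : ℝ≥0∞)), sqrtRatio (f x) (g x) = 1) :
    ν.withDensity (fun x => (f x : ℝ≥0∞)) = ν.withDensity (fun x => (g x : ℝ≥0∞)) := by
  rw [ae_withDensity_iff hg.coe_nnreal_ennreal] at h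
  symm
  refine Measure.eq_of_le_of_isProbabilityMeasure ?_
  refine withDensity_mono ?_
  filter_upwards [h] with x hx
  rcases eq_or_ne (g x) 0 with h0 | h0
  · simp [h0]
  · rw [(sqrtRatio_eq_one h0).mp (hx (by simpa using h0))]

theorem ae_density_ne_zero (hg : Measurable g) :
    ∀ᵐ x ∂(ν.withDensity fun x => (g x : ℝ≥0∞)), g x ≠ 0 := by
  rw [ae_withDensity_iff hg.coe_nnreal_ennreal]
  exact .of_forall fun x hx => by simpa using hx

end Hellinger

/-! ### The affinity of two laws of trajectories -/

section Affinity

variable {k : ℕ} {μ : Measure (Euc k)} [IsProbabilityMeasure μ]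
  {κ : Kernel (Euc k) (Euc k)} [IsMarkovKernel κ]

/-- The product of `h` over the transitions of a trajectory. -/
noncomputable def transitionProd (h : Euc k → Euc k → ℝ≥0∞) (T : ℕ)
    (τ : Fin (T + 1) → Euc k) : ℝ≥0∞ :=
  ∏ i : Fin T, h (τ i.castSucc) (τ i.succ)

theorem measurable_transitionProd {h : Euc k → Euc k → ℝ≥0∞} (hh : Measurable (Function.uncurry h))
    (T : ℕ) : Measurable (transitionProd h T) := by
  unfold transitionProd
  refine Finset.measurable_fun_prod _ fun i _ => ?_
  exact hh.comp ((measurable_pi_apply (X := fun _ : Fin (T + 1) => Euc k) i.castSucc).prodMk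
    (measurable_pi_apply (X := fun _ : Fin (T + 1) => Euc k) i.succ))

theorem transitionProd_snoc (h : Euc k → Euc k → ℝ≥0∞) (T : ℕ) (τ : Fin (T + 1) → Euc k)
    (s : Euc k) : transitionProd h (T + 1) (Fin.snoc (α := fun _ => Euc k) τ s) =
      transitionProd h T τ * h (τ (Fin.last T)) s := by
  simp only [transitionProd]
  rw [Fin.prod_univ_castSucc]
  congr 1
  · refine Finset.prod_congr rfl fun i _ => ?_
    rw [Fin.succ_castSucc]
    simp only [Fin.snoc_castSucc]
  · rw [Fin.succ_last]
    simp only [Fin.snoc_castSucc, Fin.snoc_last]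

theorem lintegral_transitionProd_succ {h : Euc k → Euc k → ℝ≥0∞}
    (hh : Measurable (Function.uncurry h)) (T : ℕ) :
    ∫⁻ τ, transitionProd h (T + 1) τ ∂(trajLaw μ κ (T + 1)) =
      ∫⁻ τ, transitionProd h T τ * ∫⁻ s, h (τ (Fin.last T)) s ∂(κ (τ (Fin.last T)))
        ∂(trajLaw μ κ T) := by
  rw [lintegral_trajLaw_succ T (measurable_transitionProd hh _)]
  refine lintegral_congr fun τ => ?_
  simp only [transitionProd_snoc]
  exact lintegral_const_mul _ (hh.comp measurable_prodMk_left)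

theorem lintegral_transitionProd_le_one {h : Euc k → Euc k → ℝ≥0∞}
    (hh : Measurable (Function.uncurry h))
    (hle : ∀ t, ∀ᵐ τ ∂(trajLaw μ κ t), ∫⁻ s, h (τ (Fin.last t)) s ∂(κ (τ (Fin.last t))) ≤ 1)
    (T : ℕ) : ∫⁻ τ, transitionProd h T τ ∂(trajLaw μ κ T) ≤ 1 := by
  induction T with
  | zero => simp [transitionProd]
  | succ T ih =>
    rw [lintegral_transitionProd_succ hh]
    refine le_trans (lintegral_mono_ae ?_) ih
    filter_upwards [hle T] with τ hτ using mul_le_of_le_one_right' hτ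

/-- If the expected product of `h` along a trajectory attains its upper bound `1`, then so does the
conditional expectation of `h` at almost every visited state. The induction also carries the fact
that the product is then almost surely `1`, so that the last factor can be isolated. -/
theorem ae_lintegral_eq_one_of_lintegral_transitionProd_eq_one {h : Euc k → Euc k → ℝ≥0∞}
    (hh : Measurable (Function.uncurry h))
    (hle : ∀ t, ∀ᵐ τ ∂(trajLaw μ κ t), ∫⁻ s, h (τ (Fin.last t)) s ∂(κ (τ (Fin.last t))) ≤ 1)
    (heq : ∀ t, ∀ᵐ τ ∂(trajLaw μ κ t), ∫⁻ s, h (τ (Fin.last t)) s ∂(κ (τ (Fin.last t))) = 1 →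
      ∀ᵐ s ∂(κ (τ (Fin.last t))), h (τ (Fin.last t)) s = 1)
    {T : ℕ} (hT : ∫⁻ τ, transitionProd h T τ ∂(trajLaw μ κ T) = 1) :
    (∀ t < T, ∀ᵐ τ ∂(trajLaw μ κ t), ∫⁻ s, h (τ (Fin.last t)) s ∂(κ (τ (Fin.last t))) = 1) ∧
      ∀ᵐ τ ∂(trajLaw μ κ T), transitionProd h T τ = 1 := by
  induction T with
  | zero => exact ⟨fun t ht => absurd ht t.not_lt_zero, by simp [transitionProd]⟩
  | succ T ih =>
    rw [lintegral_transitionProd_succ hh] at hT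
    have hT' : ∫⁻ τ, transitionProd h T τ ∂(trajLaw μ κ T) = 1 := by
      refine le_antisymm (lintegral_transitionProd_le_one hh hle T) (hT ▸ lintegral_mono_ae ?_)
      filter_upwards [hle T] with τ hτ using mul_le_of_le_one_right' hτ
    obtain ⟨h1, h2⟩ := ih hT'
    have h3 : ∫⁻ τ, ∫⁻ s, h (τ (Fin.last T)) s ∂(κ (τ (Fin.last T))) ∂(trajLaw μ κ T) = 1 := by
      rw [← hT]
      refine lintegral_congr_ae ?_
      filter_upwards [h2] with τ hτ
      rw [hτ, one_mul]
    have h4 : ∀ᵐ τ ∂(trajLaw μ κ T), ∫⁻ s, h (τ (Fin.last T)) s ∂(κ (τ (Fin.last T))) = 1 :=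
      ae_eq_of_ae_le_of_lintegral_le (g := fun _ => 1) (hle T) (by simp [h3])
        aemeasurable_const (by simp [h3])
    refine ⟨fun t ht => ?_, ?_⟩
    · rcases Nat.lt_succ_iff_lt_or_eq.mp ht with ht | rfl
      · exact h1 t ht
      · exact h4
    · refine ae_trajLaw_succ (measurable_transitionProd hh _ (measurableSet_singleton 1)) ?_
      filter_upwards [h2, h4, heq T] with τ h5 h6 h7
      filter_upwards [h7 h6] with s hs
      rw [transitionProd_snoc, h5, hs, one_mul]

end Affinity

/-! ### Continuity of the model transitions -/

section Feller

variable {k m d : ℕ}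

theorem SDEModel.integral_transition (M : SDEModel k m d) (π : C(Euc k, Euc m)) (s : Euc k)
    (f : BoundedContinuousFunction (Euc k) ℝ) :
    ∫ s', f s' ∂(M.transition π s) = ∫ w, f (M.step π s w) ∂(stdGaussian (Euc d)) :=
  integral_map ((M.continuous_step π).comp (Continuous.prodMk_right s)).aemeasurable
    f.continuous.aestronglyMeasurable

/-- The transition kernel of a model has the Feller property. -/
theorem SDEModel.continuous_integral_transition (M : SDEModel k m d) (π : C(Euc k, Euc m))
    (f : BoundedContinuousFunction (Euc k) ℝ) :
    Continuous fun s => ∫ s', f s' ∂(M.transition π s) := by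
  simp only [M.integral_transition]
  have hc : Continuous fun x : Euc k × Euc d => f (M.step π x.1 x.2) :=
    f.continuous.comp (M.continuous_step π)
  refine continuous_of_dominated (bound := fun _ => ‖f‖) (fun s => ?_) (fun s => ?_)
    (integrable_const _) ?_
  · exact (hc.comp (Continuous.prodMk_right s)).aestronglyMeasurable
  · exact .of_forall fun w => f.norm_coe_le_norm _
  · exact .of_forall fun w => hc.comp (Continuous.prodMk_left w)

theorem SDEModel.isClosed_setOf_transition_eq (M M' : SDEModel k m d) (π : C(Euc k, Euc m)) :
    IsClosed {s | M.transition π s = M'.transition π s} := by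
  have : {s | M.transition π s = M'.transition π s} =
      ⋂ f : BoundedContinuousFunction (Euc k) ℝ,
        {s | ∫ s', f s' ∂(M.transition π s) = ∫ s', f s' ∂(M'.transition π s)} := by
    ext s
    simp only [Set.mem_iInter, Set.mem_ofPred_eq]
    exact ⟨fun h f => by rw [h], ext_of_forall_integral_eq_of_IsFiniteMeasure⟩
  rw [this]
  exact isClosed_iInter fun f => isClosed_eq (M.continuous_integral_transition π f)
    (M'.continuous_integral_transition π f)

end Feller

/-! ### Maximum likelihood fits -/

section Likelihood

variable {k : ℕ}

theorem likelihoodLoss_eq_neg_log {T : ℕ} (p : Euc k → Euc k → ℝ≥0) (n : ℕ)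
    (τ : ℕ → Fin (T + 1) → Euc k) :
    likelihoodLoss p n τ = -ENNReal.log
      ((∏ i ∈ Finset.range n, ∏ t : Fin T, p (τ i t.castSucc) (τ i t.succ) : ℝ≥0) : ℝ≥0∞) := by
  have h : ∀ {β : Type} (s : Finset β) (f : β → ℝ≥0∞),
      ENNReal.log (∏ i ∈ s, f i) = ∑ i ∈ s, ENNReal.log (f i) := by
    classical
    intro β s f
    induction s using Finset.induction_on with
    | empty => simp
    | insert a s ha ih => rw [Finset.prod_insert ha, Finset.sum_insert ha, ENNReal.log_mul_add, ih]
  rw [likelihoodLoss]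
  push_cast
  simp only [h]

/-- If `p` fits the data at least as well as `q`, and `q` is positive on the data, then the product
of the square roots of the likelihood ratios is at least `1`. -/
theorem one_le_prod_transitionProd_of_likelihoodLoss_le {T : ℕ} {p q : Euc k → Euc k → ℝ≥0} {n : ℕ}
    {τ : ℕ → Fin (T + 1) → Euc k} (hq : ∀ i, ∀ t : Fin T, q (τ i t.castSucc) (τ i t.succ) ≠ 0)
    (h : likelihoodLoss p n τ ≤ likelihoodLoss q n τ) :
    1 ≤ ∏ i ∈ Finset.range n, transitionProd (fun s s' => sqrtRatio (p s s') (q s s')) T (τ i) := by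
  rw [likelihoodLoss_eq_neg_log, likelihoodLoss_eq_neg_log, EReal.neg_le_neg_iff,
    ENNReal.log_le_log_iff, ENNReal.coe_le_coe] at h
  have hpos : 0 < ∏ i ∈ Finset.range n, ∏ t : Fin T, q (τ i t.castSucc) (τ i t.succ) :=
    Finset.prod_pos fun i _ => Finset.prod_pos fun t _ => pos_iff_ne_zero.mpr (hq i t)
  simp only [transitionProd, sqrtRatio]
  norm_cast
  have hsq : (∏ i ∈ Finset.range n, ∏ t : Fin T,
      NNReal.sqrt (p (τ i t.castSucc) (τ i t.succ) / q (τ i t.castSucc) (τ i t.succ))) ^ 2 =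
      (∏ i ∈ Finset.range n, ∏ t : Fin T, p (τ i t.castSucc) (τ i t.succ)) /
        ∏ i ∈ Finset.range n, ∏ t : Fin T, q (τ i t.castSucc) (τ i t.succ) := by
    simp only [← Finset.prod_pow, NNReal.sq_sqrt, Finset.prod_div_distrib]
  rw [← one_le_sq_iff₀ zero_le, hsq, one_le_div hpos]
  exact h

/-- A product of independent nonnegative variables with common mean below `1` is almost surely
eventually below `1`, by Markov's inequality and the Borel–Cantelli lemma. -/
theorem ae_eventually_prod_lt_one {Ω : Type*} [MeasurableSpace Ω] {Q : Measure Ω}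
    {X : ℕ → Ω → ℝ≥0∞} (hX : ∀ i, Measurable (X i)) (hindep : iIndepFun X Q) {ρ : ℝ≥0∞}
    (hρ : ρ < 1) (hmean : ∀ i, ∫⁻ ω, X i ω ∂Q = ρ) :
    ∀ᵐ ω ∂Q, ∀ᶠ n in atTop, ∏ i ∈ Finset.range n, X i ω < 1 := by
  have hbound : ∀ n, Q {ω | 1 ≤ ∏ i ∈ Finset.range n, X i ω} ≤ ρ ^ n := fun n => by
    have := mul_meas_ge_le_lintegral₀ (μ := Q)
      (Finset.measurable_fun_prod (Finset.range n) fun i _ => hX i).aemeasurable 1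
    rw [one_mul, lintegral_prod_eq_prod_lintegral_of_indepFun _ _ hindep hX] at this
    simpa [hmean] using this
  have hsum : ∑' n, Q {ω | 1 ≤ ∏ i ∈ Finset.range n, X i ω} ≠ ∞ := by
    refine ne_top_of_le_ne_top ?_ (ENNReal.tsum_le_tsum hbound)
    rw [ENNReal.tsum_geometric]
    exact ENNReal.inv_ne_top.mpr (tsub_pos_of_lt hρ).ne'
  filter_upwards [ae_eventually_notMem hsum] with ω hω
  filter_upwards [hω] with n hn
  exact not_le.mp hn

variable {μ : Measure (Euc k)} {ν κ κ₀ κ₁ : Kernel (Euc k) (Euc k)} {S : Set (Euc k)}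
  {p q : Euc k → Euc k → ℝ≥0}

theorem ae_trajLaw_density_ne_zero (hS : MeasurableSet S)
    (hκ : ∀ s ∈ S, κ s Sᶜ = 0) (hμ : μ Sᶜ = 0) (hq : IsTransitionDensity ν κ₀ q)
    (hκ₀ : ∀ s ∈ S, κ₀ s = κ s) (T : ℕ) :
    ∀ᵐ τ ∂(trajLaw μ κ T), ∀ i : Fin T, q (τ i.castSucc) (τ i.succ) ≠ 0 := by
  refine ae_trajLaw_forall_transition (W := {x | q x.1 x.2 ≠ 0})
    (hq.1 (measurableSet_singleton 0).compl) fun t _ => ?_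
  filter_upwards [ae_trajLaw_last_mem hS hκ hμ t] with τ hτ
  rw [← hκ₀ _ hτ, hq.2]
  exact ae_density_ne_zero (hq.1.comp measurable_prodMk_left)

variable [IsProbabilityMeasure μ] [IsMarkovKernel κ] [IsMarkovKernel κ₀] [IsMarkovKernel κ₁]

/-- A model whose transitions differ from the true ones at visited states has affinity below `1`
with the law of the trajectories. -/
theorem lintegral_transitionProd_sqrtRatio_lt_one (hS : MeasurableSet S)
    (hκ : ∀ s ∈ S, κ s Sᶜ = 0) (hμ : μ Sᶜ = 0) (hq : IsTransitionDensity ν κ₀ q)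
    (hp : IsTransitionDensity ν κ₁ p) (hκ₀ : ∀ s ∈ S, κ₀ s = κ s) {T : ℕ}
    (hne : ¬ ∀ t < T, ∀ᵐ τ ∂(trajLaw μ κ t), κ₁ (τ (Fin.last t)) = κ (τ (Fin.last t))) :
    ∫⁻ τ, transitionProd (fun s s' => sqrtRatio (p s s') (q s s')) T τ ∂(trajLaw μ κ T) < 1 := by
  have hp1 : ∀ s, Measurable (p s) := fun s => hp.1.comp measurable_prodMk_left
  have hq1 : ∀ s, Measurable (q s) := fun s => hq.1.comp measurable_prodMk_left
  have ip : ∀ s, IsProbabilityMeasure ((ν s).withDensity fun x => (p s x : ℝ≥0∞)) :=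
    fun s => hp.2 s ▸ inferInstance
  have iq : ∀ s, IsProbabilityMeasure ((ν s).withDensity fun x => (q s x : ℝ≥0∞)) :=
    fun s => hq.2 s ▸ inferInstance
  have hqκ : ∀ s ∈ S, κ s = (ν s).withDensity fun x => (q s x : ℝ≥0∞) :=
    fun s hs => (hκ₀ s hs).symm.trans (hq.2 s)
  have hh : Measurable (Function.uncurry fun s s' => sqrtRatio (p s s') (q s s')) :=
    hp.1.sqrtRatio hq.1
  have hle : ∀ t, ∀ᵐ τ ∂(trajLaw μ κ t),
      ∫⁻ s, sqrtRatio (p (τ (Fin.last t)) s) (q (τ (Fin.last t)) s) ∂(κ (τ (Fin.last t))) ≤ 1 := by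
    intro t
    filter_upwards [ae_trajLaw_last_mem hS hκ hμ t] with τ hτ
    rw [hqκ _ hτ]
    exact lintegral_sqrtRatio_le_one (hp1 _) (hq1 _)
  have heq : ∀ s ∈ S, ∫⁻ s', sqrtRatio (p s s') (q s s') ∂(κ s) = 1 →
      ∀ᵐ s' ∂(κ s), sqrtRatio (p s s') (q s s') = 1 := by
    intro s hs h1
    rw [hqκ _ hs] at h1 ⊢
    exact ae_sqrtRatio_eq_one (hp1 _) (hq1 _) h1
  refine lt_of_le_of_ne (lintegral_transitionProd_le_one hh hle T) fun h1 => hne fun t ht => ?_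
  have h2 := (ae_lintegral_eq_one_of_lintegral_transitionProd_eq_one hh hle
    (fun t => by
      filter_upwards [ae_trajLaw_last_mem hS hκ hμ t] with τ hτ using heq _ hτ) h1).1 t ht
  filter_upwards [h2, ae_trajLaw_last_mem hS hκ hμ t] with τ h3 h4
  have h5 := heq _ h4 h3
  rw [hqκ _ h4] at h5 ⊢
  rw [hp.2]
  exact withDensity_eq_of_ae_sqrtRatio_eq_one (hq1 _) h5

/-- Consistency of maximum likelihood: a model whose transitions differ from the true ones at
visited states is almost surely eventually beaten by the true model. -/
theorem ae_eventually_likelihoodLoss_lt (hS : MeasurableSet S)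
    (hκ : ∀ s ∈ S, κ s Sᶜ = 0) (hμ : μ Sᶜ = 0) (hq : IsTransitionDensity ν κ₀ q)
    (hp : IsTransitionDensity ν κ₁ p) (hκ₀ : ∀ s ∈ S, κ₀ s = κ s) {T : ℕ}
    (hne : ¬ ∀ t < T, ∀ᵐ τ ∂(trajLaw μ κ t), κ₁ (τ (Fin.last t)) = κ (τ (Fin.last t)))
    {Ω : Type*} [MeasurableSpace Ω] {Q : Measure Ω} {τ : ℕ → Ω → Fin (T + 1) → Euc k}
    (hτ_meas : ∀ i, Measurable (τ i)) (hτ_law : ∀ i, Q.map (τ i) = trajLaw μ κ T)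
    (hτ_indep : iIndepFun τ Q) :
    ∀ᵐ ω ∂Q, ∀ᶠ n in atTop,
      likelihoodLoss q n (fun i => τ i ω) < likelihoodLoss p n (fun i => τ i ω) := by
  have hH := measurable_transitionProd (h := fun s s' => sqrtRatio (p s s') (q s s'))
    (hp.1.sqrtRatio hq.1) T
  have hpos : ∀ᵐ ω ∂Q, ∀ i, ∀ t : Fin T, q (τ i ω t.castSucc) (τ i ω t.succ) ≠ 0 := by
    refine ae_all_iff.mpr fun i => ?_
    have := ae_trajLaw_density_ne_zero hS hκ hμ hq hκ₀ T
    rw [← hτ_law i] at this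
    exact ae_of_ae_map (hτ_meas i).aemeasurable this
  have hlt := ae_eventually_prod_lt_one (fun i => hH.comp (hτ_meas i))
    (hτ_indep.comp _ fun _ => hH)
    (lintegral_transitionProd_sqrtRatio_lt_one hS hκ hμ hq hp hκ₀ hne)
    fun i => by rw [← hτ_law i, lintegral_map hH (hτ_meas i)]; rfl
  filter_upwards [hpos, hlt] with ω h1 h2
  filter_upwards [h2] with n hn
  by_contra! hle
  exact absurd (one_le_prod_transitionProd_of_likelihoodLoss_le h1 hle) (not_le.mpr hn)

end Likelihood

end SoftBarrier

/-! ### The safety bound for fitted models -/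

theorem proposition1
    {k m d T : ℕ}
    -- state space, initial set, unsafe set
    (S S0 Su : Set (Euc k))
    (hS : MeasurableSet S) (hS0 : MeasurableSet S0) (hSu : MeasurableSet Su)
    (hS0S : S0 ⊆ S) (hSuS : Su ⊆ S)
    -- learned policy and unknown environment, whose states stay in `S`
    (π : C(Euc k, Euc m))
    (P : Kernel (Euc k × Euc m) (Euc k)) [IsMarkovKernel P]
    (hPS : ∀ s ∈ S, closedLoop P π s Sᶜ = 0)
    -- law of the initial state
    (μ0 : Measure (Euc k)) [IsProbabilityMeasure μ0]
    (hμ0S : μ0 Sᶜ = 0) (hμ0S0 : μ0 S0 ≠ 0)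
    -- finite class of models, containing the true closed-loop dynamics
    {ι : Type*} [Finite ι] (model : ι → SDEModel k m d)
    (hreal : ∃ α, ∀ s ∈ S, (model α).transition π s = closedLoop P π s)
    -- likelihood functions of the models
    (ν : Kernel (Euc k) (Euc k)) [IsSFiniteKernel ν]
    (p : ι → Euc k → Euc k → ℝ≥0)
    (hp : ∀ α, IsTransitionDensity ν ((model α).transition π) (p α))
    -- independent sample trajectories of the environment under the policy
    {Ω : Type*} [MeasurableSpace Ω] (Q : Measure Ω) [IsProbabilityMeasure Q]
    (τ : ℕ → Ω → Fin (T + 1) → Euc k)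
    (hτ_meas : ∀ i, Measurable (τ i))
    (hτ_law : ∀ i, Q.map (τ i) = trajLaw μ0 (closedLoop P π) T)
    (hτ_indep : iIndepFun τ Q) :
    (∀ᵐ ω ∂Q, ∀ᶠ n in atTop, ∀ α, IsMaxLikelihood p n (fun i => τ i ω) α →
      ∀ (B : Euc k → ℝ) (η : ℝ), IsSoftBarrier ((model α).transition π) S S0 Su B η →
        1 - η ≤ safetyProb μ0 (closedLoop P π) S0 Su T) ∧
    ((∀ᵐ ω ∂Q, DataCovers S (fun i => τ i ω)) →
      ∀ᵐ ω ∂Q, ∀ᶠ n in atTop, ∀ α, IsMaxLikelihood p n (fun i => τ i ω) α →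
        ∀ (B : Euc k → ℝ) (η : ℝ), IsSoftBarrier ((model α).transition π) S S0 Su B η →
          ∀ s0 ∈ S0,
            1 - η ≤ (trajLaw (Measure.dirac s0) (closedLoop P π) T).real (safeEvent Su T)) := by
  obtain ⟨α₀, hα₀⟩ := hreal
  -- Almost surely, every maximum likelihood fit eventually agrees with the environment at visited
  -- states; the barrier inequality applies to such a fit as to the true dynamics.
  have hfit : ∀ᵐ ω ∂Q, ∀ᶠ n in atTop, ∀ α, IsMaxLikelihood p n (fun i => τ i ω) α →
      ∀ t < T, ∀ᵐ x ∂(trajLaw μ0 (closedLoop P π) t),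
        (model α).transition π (x (Fin.last t)) = closedLoop P π (x (Fin.last t)) := by
    have h : ∀ α, ∀ᵐ ω ∂Q, ∀ᶠ n in atTop, IsMaxLikelihood p n (fun i => τ i ω) α →
        ∀ t < T, ∀ᵐ x ∂(trajLaw μ0 (closedLoop P π) t),
          (model α).transition π (x (Fin.last t)) = closedLoop P π (x (Fin.last t)) := by
      intro α
      by_cases hα : ∀ t < T, ∀ᵐ x ∂(trajLaw μ0 (closedLoop P π) t),
          (model α).transition π (x (Fin.last t)) = closedLoop P π (x (Fin.last t))
      · exact .of_forall fun ω => .of_forall fun n _ => hα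
      · filter_upwards [ae_eventually_likelihoodLoss_lt hS hPS hμ0S (hp α₀) (hp α) hα₀ hα
          hτ_meas hτ_law hτ_indep] with ω hω
        filter_upwards [hω] with n hn hfit
        exact absurd (hfit α₀) (not_le.mpr hn)
    filter_upwards [ae_all_iff.mpr h] with ω hω using eventually_all.mpr hω
  refine ⟨?_, fun hcover => ?_⟩
  · filter_upwards [hfit] with ω hω
    filter_upwards [hω] with n hn α hα B η hB
    exact hB.one_sub_le_safetyProb hS hS0 hSu hS0S hPS hμ0S hμ0S0 (hn α hα)
  · -- The states in the data are among the visited states, so the agreement holds on the data, and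
    -- by the Feller property on its closure.
    have hdata : ∀ᵐ ω ∂Q, ∀ α, (∀ t < T, ∀ᵐ x ∂(trajLaw μ0 (closedLoop P π) t),
        (model α).transition π (x (Fin.last t)) = closedLoop P π (x (Fin.last t))) →
        ∀ i, ∀ t : Fin T, (model α).transition π (τ i ω t.castSucc) =
          (model α₀).transition π (τ i ω t.castSucc) := by
      refine ae_all_iff.mpr fun α => ?_
      by_cases hα : ∀ t < T, ∀ᵐ x ∂(trajLaw μ0 (closedLoop P π) t),
          (model α).transition π (x (Fin.last t)) = closedLoop P π (x (Fin.last t))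
      · have h : ∀ᵐ ω ∂Q, ∀ i, ∀ t : Fin T, (model α).transition π (τ i ω t.castSucc) =
            (model α₀).transition π (τ i ω t.castSucc) := by
          refine ae_all_iff.mpr fun i => ?_
          have := ae_trajLaw_forall_lt (μ := μ0) (κ := closedLoop P π) (T := T)
            (R := fun s => (model α).transition π s = (model α₀).transition π s) fun t ht => by
              filter_upwards [hα t ht, ae_trajLaw_last_mem hS hPS hμ0S t] with x h1 h2
              exact h1.trans (hα₀ _ h2).symm
          rw [← hτ_law i] at this
          exact ae_of_ae_map (hτ_meas i).aemeasurable this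
        filter_upwards [h] with ω hω _ using hω
      · exact .of_forall fun ω h => absurd h hα
    filter_upwards [hfit, hdata, hcover] with ω hω hdataω hcoverω
    filter_upwards [hω] with n hn α hα B η hB s0 hs0
    have hagree : ∀ s ∈ S, (model α).transition π s = closedLoop P π s := by
      intro s hs
      rw [← hα₀ s hs]
      refine closure_minimal ?_ ((model α).isClosed_setOf_transition_eq (model α₀) π) (hcoverω hs)
      rintro _ ⟨i, t, rfl⟩
      exact hdataω α (hn α hα) i t
    have hdirac : Measure.dirac s0 Sᶜ = 0 := by
      rw [Measure.dirac_apply' _ hS.compl]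
      simp [hS0S hs0]
    have hmem : Measure.dirac s0 S0 = 1 := by
      rw [Measure.dirac_apply' _ hS0]
      simp [hs0]
    have hle := hB.one_sub_le_safetyProb hS hS0 hSu hS0S hPS hdirac (by simp [hmem]) (T := T)
      fun t _ => by
        filter_upwards [ae_trajLaw_last_mem hS hPS hdirac t] with x hx using hagree _ hx
    rwa [safetyProb_eq_of_measure_eq_one hS0 hmem] at hle
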